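/- Draw a crossing of an unoriented link diagram with its ends at NW, SW, SE, NE and with the strand SW--NE passing over the strand NW--SE. Its smoothings $L_0$ and $L_\infty$ are obtained by replacing it by $)($ (joining NW to SW and SE to NE) and by $\asymp$ (joining SW to SE and NE to NW), respectively. Let $\det$ denote the determinant of a link, $\det(L)=|V_L(-1)|$ with $V_L$ the Jones polynomial. The set $\mathcal Q$ of quasi-alternating links is the smallest set of links that contains the unknot and contains every link having a diagram with a crossing $c$ such that both smoothings $L_0,L_\infty$ at $c$ belong to $\mathcal Q$, $\det(L_0)\ge 1$, $\det(L_\infty)\ge 1$ and $\det(L)=\det(L_0)+\det(L_\infty)$; such a crossing $c$ is called a quasi-alternating crossing of the diagram. Let $L$ be a link diagram, let $c$ be a quasi-alternating crossing of $L$, drawn as above, and let $n>1$ be an integer. 1. Let $L'$ be the diagram obtained from $L$ by replacing $c$ by $n$ vertical half twists of the same type, that is, by $n$ crossings, each drawn as above, stacked from top to bottom, the ends SW and SE of each being joined to the ends NW and NE of the next. Then $\det(L'_\infty)<\det(L'_0)$, where $L'_0$ and $L'_\infty$ are the smoothings of $L'$ at any one of the $n$ new crossings $c'$. 2. Let $L'$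 be the diagram obtained from $L$ by replacing $c$ by $n$ horizontal half twists of the same type, that is, by $n$ crossings, each drawn as above, in a row from left to right, the ends NE and SE of each being joined to the ends NW and SW of the next. Then $\det(L'_\infty)>\det(L'_0)$, where $L'_0$ and $L'_\infty$ are the smoothings of $L'$ at any one of the $n$ new crossings $c'$. -/

import Mathlib

/-!
Unoriented link diagrams on the sphere are encoded by planar diagram codes.  Every crossing has
four ends, numbered `0, 1, 2, 3` counterclockwise, the ends `0` and `2` being those of the
under-strand and `1` and `3` those of the over-strand.  We picture a crossing with its ends at
`0 = NW`, `1 = SW`, `2 = SE`, `3 = NE`.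
-/

/-- A planar diagram code: finitely many crossings, finitely many edge labels, and the label of
the edge at each of the four ends of each crossing.  A label which is attached to no crossing
stands for a circle without crossings. -/
structure PDCode where
  Crossing : Type
  Edge : Type
  [finite_crossing : Finite Crossing]
  [finite_edge : Finite Edge]
  inc : Crossing → Fin 4 → Edge

attribute [instance] PDCode.finite_crossing PDCode.finite_edge

/-- A tangle diagram in a disc with `k` boundary points numbered counterclockwise; `bd j` is the
label of the edge which ends at the boundary point `j`. -/
structure Tangle (k : ℕ) extends PDCode where
  bd : Fin k → Edge

namespace Tangle

/-- The identification of the edges at the common boundary points of two tangles. -/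
def GlueRel {k : ℕ} (O T : Tangle k) (x y : O.Edge ⊕ T.Edge) : Prop :=
  ∃ j : Fin k, x = Sum.inl (O.bd j) ∧ y = Sum.inr (T.bd j)

/-- The diagram obtained by filling a disc with the tangle `T`, where `O` is the part of the
diagram outside the disc (with the boundary points in the numbering of `T`). -/
def glue {k : ℕ} (O T : Tangle k) : PDCode where
  Crossing := O.Crossing ⊕ T.Crossing
  Edge := Quot (GlueRel O T)
  inc := Sum.elim
    (fun c i => Quot.mk _ (Sum.inl (O.inc c i)))
    (fun c i => Quot.mk _ (Sum.inr (T.inc c i)))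

/-- The tangle `)(`: two vertical arcs, from NW to SW and from SE to NE. -/
def zero : Tangle 4 where
  Crossing := Empty
  Edge := Bool
  inc := fun c => c.elim
  bd := ![false, false, true, true]

/-- The tangle `≍`: two horizontal arcs, from SW to SE and from NE to NW. -/
def infty : Tangle 4 where
  Crossing := Empty
  Edge := Bool
  inc := fun c => c.elim
  bd := ![false, true, true, false]

/-- `n` vertical half twists: `n` crossings, each of them in the standard picture, stacked from top
to bottom.  The edge `(k, false)` (resp. `(k, true)`) is the left (resp. right) one at level `k`. -/
def vertical (n : ℕ) : Tangle 4 where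
  Crossing := Fin n
  Edge := Fin (n + 1) × Bool
  inc := fun i => ![(i.castSucc, false), (i.succ, false), (i.succ, true), (i.castSucc, true)]
  bd := ![(0, false), (Fin.last n, false), (Fin.last n, true), (0, true)]

/-- `n` horizontal half twists: `n` crossings, each of them in the standard picture, in a row from
left to right.  The edge `(k, false)` (resp. `(k, true)`) is the upper (resp. lower) one at
place `k`. -/
def horizontal (n : ℕ) : Tangle 4 where
  Crossing := Fin n
  Edge := Fin (n + 1) × Bool
  inc := fun i => ![(i.castSucc, false), (i.castSucc, true), (i.succ, true), (i.succ, false)]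
  bd := ![(0, false), (0, true), (Fin.last n, true), (Fin.last n, false)]

/-- An arc without crossings. -/
def arc : Tangle 2 where
  Crossing := Empty
  Edge := Unit
  inc := fun c => c.elim
  bd := fun _ => ()

/-- An arc with one kink, of one of the two signs; the edge `2` is the small loop. -/
def kink (sign : Bool) : Tangle 2 where
  Crossing := Unit
  Edge := Fin 3
  inc := fun _ => if sign then ![2, 2, 0, 1] else ![0, 2, 2, 1]
  bd := ![0, 1]

/-- Two arcs from NW to SW and from NE to SE; the first one passes over the second one at two
crossings (`false` is the upper, `true` the lower crossing).  The edges `0, 1, 2, 3` are those at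
the boundary, the edges `4` (left) and `5` (right) bound the bigon. -/
def clasp : Tangle 4 where
  Crossing := Bool
  Edge := Fin 6
  inc := fun c => if c then ![4, 1, 2, 5] else ![4, 5, 3, 0]
  bd := ![0, 1, 2, 3]

/-- The ends of a crossing of two strands, from the labels `w, x, y, z` of its ends in
counterclockwise order: if `b` then the strand `w, y` is the lower one, else the strand `x, z`. -/
def ends {α : Type} (b : Bool) (w x y z : α) : Fin 4 → α :=
  if b then ![w, x, y, z] else ![x, y, z, w]

/-- Three strands, the strand `s` running from the boundary point `s` to the boundary point `s + 3`
of a hexagon at the height `h s`, any two of them crossing once.  The edge `(s, m)` is the `m`-th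
segment of the strand `s`.  The crossing `i` is the one of the two strands other than `i`.  The two
values of `side` are the two positions of the strand `0` relative to the crossing of the other
two. -/
def triangle (h : Equiv.Perm (Fin 3)) (side : Bool) : Tangle 6 where
  Crossing := Fin 3
  Edge := Fin 3 × Fin 3
  inc := if side then
      ![ends (decide (h 1 < h 2)) (1, 1) (2, 1) (1, 2) (2, 2),
        ends (decide (h 0 < h 2)) (0, 1) (2, 0) (0, 2) (2, 1),
        ends (decide (h 0 < h 1)) (0, 0) (1, 0) (0, 1) (1, 1)]
    else
      ![ends (decide (h 1 < h 2)) (1, 0) (2, 0) (1, 1) (2, 1),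
        ends (decide (h 0 < h 2)) (0, 0) (2, 1) (0, 1) (2, 2),
        ends (decide (h 0 < h 1)) (0, 1) (1, 1) (0, 2) (1, 2)]
  bd := ![(0, 0), (1, 0), (2, 0), (0, 2), (1, 2), (2, 2)]

end Tangle

namespace PDCode

/-! ### Link diagrams -/

/-- The corner `(c, k)` is the one between the ends `k` and `k + 1` of `c`.  Two corners are related
if they follow each other along the boundary of a region: the region to the left of the edge which
leaves `p.1` through its end `p.2` is seen at the other end of that edge, the end `q.2 + 1` of
`q.1`, as the corner `q`. -/
def CornerRel (D : PDCode) (p q : D.Crossing × Fin 4) : Prop :=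
  p ≠ (q.1, q.2 + 1) ∧ D.inc p.1 p.2 = D.inc q.1 (q.2 + 1)

/-- Two crossings are adjacent if they share an edge. -/
def AdjRel (D : PDCode) (c c' : D.Crossing) : Prop :=
  ∃ i j : Fin 4, D.inc c i = D.inc c' j

/-- A planar diagram code is a link diagram on the sphere if every edge has two ends at crossings
(or none, for circles without crossings) and if all connected components of its underlying
four-valent map have genus zero.  The second condition is Euler's formula `V - E + F = 2κ`, where
`E = 2V`. -/
def IsLinkDiagram (D : PDCode) : Prop :=
  (∀ e : D.Edge,
    Nat.card {p : D.Crossing × Fin 4 // D.inc p.1 p.2 = e} = 0 ∨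
    Nat.card {p : D.Crossing × Fin 4 // D.inc p.1 p.2 = e} = 2) ∧
  Nat.card (Quot D.CornerRel) = Nat.card D.Crossing + 2 * Nat.card (Quot D.AdjRel)

/-- The circle without crossings. -/
def unknot : PDCode where
  Crossing := Empty
  Edge := Unit
  inc := fun c => c.elim

/-! ### Replacing a crossing by a tangle, smoothings -/

/-- The exterior of a small disc around the crossing `c`. -/
def exterior (D : PDCode) (c : D.Crossing) : Tangle 4 where
  Crossing := {x : D.Crossing // x ≠ c}
  Edge := D.Edge
  inc := fun x => D.inc x.1
  bd := D.inc c

/-- The diagram obtained from `D` by replacing the crossing `c` by the tangle `T`. -/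
def replace (D : PDCode) (c : D.Crossing) (T : Tangle 4) : PDCode :=
  (D.exterior c).glue T

/-- The smoothing `L₀` at the crossing `c`. -/
def smoothZero (D : PDCode) (c : D.Crossing) : PDCode := D.replace c Tangle.zero

/-- The smoothing `L_∞` at the crossing `c`. -/
def smoothInfty (D : PDCode) (c : D.Crossing) : PDCode := D.replace c Tangle.infty

/-- The diagram with `c` replaced by `n` vertical half twists of the same type as `c`. -/
def verticalTwist (D : PDCode) (c : D.Crossing) (n : ℕ) : PDCode :=
  D.replace c (Tangle.vertical n)

/-- The diagram with `c` replaced by `n` horizontal half twists of the same type as `c`. -/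
def horizontalTwist (D : PDCode) (c : D.Crossing) (n : ℕ) : PDCode :=
  D.replace c (Tangle.horizontal n)

/-- The `i`-th of the new crossings of `D.verticalTwist c n`. -/
def verticalCrossing (D : PDCode) (c : D.Crossing) (n : ℕ) (i : Fin n) :
    (D.verticalTwist c n).Crossing := Sum.inr i

/-- The `i`-th of the new crossings of `D.horizontalTwist c n`. -/
def horizontalCrossing (D : PDCode) (c : D.Crossing) (n : ℕ) (i : Fin n) :
    (D.horizontalTwist c n).Crossing := Sum.inr i

/-! ### The determinant -/

/-- The identification of edges at the crossings in the Kauffman state `s`.  At a crossing with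
`s c = true` we take the `A`-smoothing `)(`, which joins `0` to `1` and `2` to `3`; otherwise the
`B`-smoothing `≍`, which joins `1` to `2` and `3` to `0`. -/
def StateRel (D : PDCode) (s : D.Crossing → Bool) (e f : D.Edge) : Prop :=
  ∃ c : D.Crossing,
    (s c = true ∧ ((e = D.inc c 0 ∧ f = D.inc c 1) ∨ (e = D.inc c 2 ∧ f = D.inc c 3))) ∨
    (s c = false ∧ ((e = D.inc c 1 ∧ f = D.inc c 2) ∨ (e = D.inc c 3 ∧ f = D.inc c 0)))

/-- The number of circles of the Kauffman state `s`. -/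
noncomputable def circles (D : PDCode) (s : D.Crossing → Bool) : ℕ :=
  Nat.card (Quot (D.StateRel s))

/-- The Kauffman bracket at `A ≠ 0`, normalised to be `1` on the circle without crossings. -/
noncomputable def bracket (D : PDCode) (A : ℂ) : ℂ :=
  ∑ᶠ s : D.Crossing → Bool,
    A ^ ((Nat.card {c // s c = true} : ℤ) - (Nat.card {c // s c = false} : ℤ)) *
      (-A ^ (2 : ℤ) - A ^ (-2 : ℤ)) ^ (D.circles s - 1)

/-- The determinant `|V(-1)|`, where `V` is the Jones polynomial.  Since
`V(t) = (-A ^ 3) ^ (-w) * ⟨D⟩` with `t = A ^ (-4)` and `w` the writhe, it is the absolute value of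
the Kauffman bracket at `A = exp (π i / 4)`. -/
noncomputable def det (D : PDCode) : ℝ :=
  ‖D.bracket (Complex.exp (Real.pi * Complex.I / 4))‖

/-! ### Equivalence of diagrams -/

/-- `D` and `D'` are equal up to the names of the crossings and edges and up to the choice of
the end `0` among the two ends of the under-strand of each crossing. -/
def Iso (D D' : PDCode) : Prop :=
  ∃ (φ : D.Crossing ≃ D'.Crossing) (ψ : D.Edge ≃ D'.Edge) (r : D.Crossing → Bool),
    ∀ (c : D.Crossing) (i : Fin 4),
      D'.inc (φ c) (if r c then i + 2 else i) = ψ (D.inc c i)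

/-- Reidemeister moves (in one direction), and renaming. -/
inductive Move : PDCode → PDCode → Prop
  | iso {D D' : PDCode} : D.Iso D' → Move D D'
  | one (O : Tangle 2) (sign : Bool) : Move (O.glue Tangle.arc) (O.glue (Tangle.kink sign))
  | two (O : Tangle 4) : Move (O.glue Tangle.zero) (O.glue Tangle.clasp)
  | three (O : Tangle 6) (h : Equiv.Perm (Fin 3)) :
      Move (O.glue (Tangle.triangle h true)) (O.glue (Tangle.triangle h false))

/-- Two link diagrams are equivalent if they are related by a finite sequence of Reidemeister moves
through link diagrams, that is, if they represent the same link. -/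
def Equivalent (D D' : PDCode) : Prop :=
  Relation.EqvGen (fun E E' => E.IsLinkDiagram ∧ E'.IsLinkDiagram ∧ Move E E') D D'

/-! ### Quasi-alternating links -/

/-- `D` is a diagram of a quasi-alternating link: the smallest class of link diagrams which is
closed under equivalence (so that it is a class of links), contains the unknot, and contains every
link with a diagram which satisfies the two conditions at one of its crossings. -/
inductive IsQuasiAlternating : PDCode → Prop
  | unknot : IsQuasiAlternating PDCode.unknot
  | crossing (D : PDCode) (c : D.Crossing) :
      D.IsLinkDiagram →
      IsQuasiAlternating (D.smoothZero c) → IsQuasiAlternating (D.smoothInfty c) →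
      1 ≤ (D.smoothZero c).det → 1 ≤ (D.smoothInfty c).det →
      D.det = (D.smoothZero c).det + (D.smoothInfty c).det →
      IsQuasiAlternating D
  | equivalent {D D' : PDCode} : D.Equivalent D' → IsQuasiAlternating D → IsQuasiAlternating D'

/-- `c` is a quasi-alternating crossing of the link diagram `D`. -/
def IsQuasiAlternatingAt (D : PDCode) (c : D.Crossing) : Prop :=
  D.IsLinkDiagram ∧
  (D.smoothZero c).IsQuasiAlternating ∧ (D.smoothInfty c).IsQuasiAlternating ∧
  1 ≤ (D.smoothZero c).det ∧ 1 ≤ (D.smoothInfty c).det ∧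
  D.det = (D.smoothZero c).det + (D.smoothInfty c).det

end PDCode

/-! At `A = exp (π i / 4)` a circle has value `-A ^ 2 - A ^ (-2) = 0`, so the bracket is the sum of
the weights of the states with a single circle (`bracket_zeta`). Let `b` be the smoothing whose arcs
run along the twist: `)(` for vertical, `≍` for horizontal twists. A state of the `n` twist
crossings equal to `b` everywhere acts as `b`; one that differs from `b` at exactly one crossing
acts as `!b`; two deviations enclose a circle inside the twist and contribute nothing.

Write `X`, `Y` for the brackets of the smoothings `b`, `!b` of `L`, and `w`, `w'` for the weights of
`b`, `!b`, all of norm 1. Smoothing one new crossing by `b` gives `w ^ (n - 2) * (w * X + (n - 1) *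
w' * Y)`, and by `!b` gives `w ^ (n - 1) * Y`. By the skein relation the bracket of `L` is `w * X +
w' * Y`, so additivity of determinants is equality in the triangle inequality: the two terms lie on
one ray, and this survives scaling. The determinants are thus `‖X‖ + (n - 1) * ‖Y‖` and `‖Y‖`, and
`‖X‖ ≥ 1` makes the inequality strict. -/

namespace Tangle

/-- The smoothing `)(` (for `true`) or `≍` (for `false`) of a crossing. -/
@[reducible] def smoothing (b : Bool) : Tangle 4 where
  Crossing := Empty
  Edge := Bool
  inc := fun c => c.elim
  bd := bif b then ![false, false, true, true] else ![false, true, true, false]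

/-- `n` vertical (for `true`) or horizontal (for `false`) half twists. -/
@[reducible] def twist (b : Bool) (n : ℕ) : Tangle 4 where
  Crossing := Fin n
  Edge := Fin (n + 1) × Bool
  inc := fun i => bif b then
      ![(i.castSucc, false), (i.succ, false), (i.succ, true), (i.castSucc, true)]
    else ![(i.castSucc, false), (i.castSucc, true), (i.succ, true), (i.succ, false)]
  bd := bif b then ![(0, false), (Fin.last n, false), (Fin.last n, true), (0, true)]
    else ![(0, false), (0, true), (Fin.last n, true), (Fin.last n, false)]

end Tangle

namespace PDCode

open Tangle

/-! ### Connected states -/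

/-- The values of `g` at the four ends of a crossing agree along the two arcs of the smoothing
`b`. -/
def Matches (b : Bool) (g : Fin 4 → Prop) : Prop :=
  if b = true then (g 0 ↔ g 1) ∧ (g 2 ↔ g 3) else (g 1 ↔ g 2) ∧ (g 3 ↔ g 0)

/-- A set of edges is invariant if it is a union of circles of the state `s`. -/
def Invariant (D : PDCode) (s : D.Crossing → Bool) (f : D.Edge → Prop) : Prop :=
  ∀ c, Matches (s c) fun i => f (D.inc c i)

/-- The state `s` has at most one circle. -/
def ConnectedState (D : PDCode) (s : D.Crossing → Bool) : Prop :=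
  ∀ f : D.Edge → Prop, D.Invariant s f → ∀ x y, f x ↔ f y

theorem forall_fin_four {p : Fin 4 → Prop} : (∀ j, p j) ↔ p 0 ∧ p 1 ∧ p 2 ∧ p 3 := by
  simp [Fin.forall_fin_succ]

/-- Testing connectedness by predicates avoids quotients of quotients: a predicate on a glued edge
set is a pair of predicates that agree on the boundary. -/
theorem subsingleton_quot_iff {α : Type*} (r : α → α → Prop) :
    Subsingleton (Quot r) ↔
      ∀ f : α → Prop, (∀ a b, r a b → (f a ↔ f b)) → ∀ x y, f x ↔ f y := by
  constructor
  · intro h f hf x y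
    have := congrArg (Quot.lift f fun a b hab => propext (hf a b hab))
      (Subsingleton.elim (Quot.mk r x) (Quot.mk r y))
    exact iff_of_eq this
  · intro h
    refine ⟨fun p q => ?_⟩
    induction p using Quot.ind with | _ x
    induction q using Quot.ind with | _ y
    -- The test predicate is membership in the class of `x`.
    exact (h (fun z => Quot.mk r x = Quot.mk r z) (fun a b hab => by rw [Quot.sound hab]) x y).1 rfl

theorem invariant_iff (D : PDCode) (s : D.Crossing → Bool) (f : D.Edge → Prop) :
    D.Invariant s f ↔ ∀ a b, D.StateRel s a b → (f a ↔ f b) := by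
  constructor
  · rintro h a b ⟨c, ⟨hs, ⟨rfl, rfl⟩ | ⟨rfl, rfl⟩⟩ | ⟨hs, ⟨rfl, rfl⟩ | ⟨rfl, rfl⟩⟩⟩
    all_goals
      have := h c
      simp only [Matches, hs] at this
      simp_all
  · intro h c
    unfold Matches
    split_ifs with hs
    · exact ⟨h _ _ ⟨c, .inl ⟨hs, .inl ⟨rfl, rfl⟩⟩⟩, h _ _ ⟨c, .inl ⟨hs, .inr ⟨rfl, rfl⟩⟩⟩⟩
    · have hs : s c = false := by simpa using hs
      exact ⟨h _ _ ⟨c, .inr ⟨hs, .inl ⟨rfl, rfl⟩⟩⟩, h _ _ ⟨c, .inr ⟨hs, .inr ⟨rfl, rfl⟩⟩⟩⟩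

/-- The bound is `≤ 1` rather than `= 1` because the exponent `circles - 1` is truncated: it also
vanishes when there are no edges. -/
theorem connectedState_iff_circles_le_one (D : PDCode) (s : D.Crossing → Bool) :
    D.ConnectedState s ↔ D.circles s ≤ 1 := by
  rw [circles, Finite.card_le_one_iff_subsingleton, subsingleton_quot_iff]
  simp only [ConnectedState, invariant_iff]

theorem connectedState_glue_iff {k : ℕ} (O T : Tangle k) (s : (O.glue T).Crossing → Bool) :
    (O.glue T).ConnectedState s ↔
      ∀ (f : O.Edge → Prop) (g : T.Edge → Prop), (∀ j, f (O.bd j) ↔ g (T.bd j)) →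
        O.Invariant (fun c => s (.inl c)) f → T.Invariant (fun c => s (.inr c)) g →
        ∀ x y, Sum.elim f g x ↔ Sum.elim f g y := by
  constructor
  · intro h f g hfg hf hg x y
    have hr : ∀ a b, GlueRel O T a b → Sum.elim f g a = Sum.elim f g b := by
      rintro _ _ ⟨j, rfl, rfl⟩
      exact propext (hfg j)
    refine h (Quot.lift (Sum.elim f g) hr) ?_ (Quot.mk _ x) (Quot.mk _ y)
    rintro (c | c)
    · exact hf c
    · exact hg c
  · intro h F hF x y
    induction x using Quot.ind with | _ x
    induction y using Quot.ind with | _ y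
    have key := h (fun e => F (Quot.mk _ (.inl e))) (fun e => F (Quot.mk _ (.inr e)))
      (fun j => by
        rw [show (Quot.mk (GlueRel O T) (.inl (O.bd j))) = Quot.mk _ (.inr (T.bd j)) from
          Quot.sound ⟨j, rfl, rfl⟩])
      (fun c => hF (.inl c)) (fun c => hF (.inr c)) x y
    rcases x with x | x <;> rcases y with y | y <;> exact key

/-- The state `s` of the tangle `O`, closed by the smoothing `b`, has at most one circle. -/
def ConnectedClosure (O : Tangle 4) (b : Bool) (s : O.Crossing → Bool) : Prop :=
  ∀ f : O.Edge → Prop, O.Invariant s f → Matches b (fun j => f (O.bd j)) → ∀ x y, f x ↔ f y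

theorem connectedState_smoothing_iff (O : Tangle 4) (b : Bool)
    (s : (O.glue (smoothing b)).Crossing → Bool) :
    (O.glue (smoothing b)).ConnectedState s ↔ ConnectedClosure O b fun c => s (.inl c) := by
  rw [connectedState_glue_iff]
  constructor
  · intro h f hf hb x y
    -- For both smoothings the arc `false` ends at boundary point `0` and the arc `true` at `2`.
    refine h f (fun e => bif e then f (O.bd 2) else f (O.bd 0)) ?_ hf (fun c => c.elim)
      (.inl x) (.inl y)
    rw [forall_fin_four]
    cases b
    · exact ⟨Iff.rfl, hb.1, Iff.rfl, hb.2⟩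
    · exact ⟨Iff.rfl, hb.1.symm, Iff.rfl, hb.2.symm⟩
  · intro h f g hfg hf _
    have hb : Matches b fun j => f (O.bd j) := by
      simp only [hfg]
      cases b <;> simp [Matches]
    have hc := h f hf hb
    have hg : ∀ e : Bool, ∃ j, (smoothing b).bd j = e := by
      intro e
      cases b <;> cases e
      exacts [⟨0, rfl⟩, ⟨2, rfl⟩, ⟨0, rfl⟩, ⟨2, rfl⟩]
    have key : ∀ z, Sum.elim f g z ↔ f (O.bd 0) := by
      rintro (z | z)
      · exact hc _ _
      · obtain ⟨j, rfl⟩ := hg z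
        exact (hfg j).symm.trans (hc _ _)
    exact fun x y => (key x).trans (key y).symm

theorem connectedState_iff_exterior (D : PDCode) (c : D.Crossing) (s : D.Crossing → Bool) :
    D.ConnectedState s ↔ ConnectedClosure (D.exterior c) (s c) fun x => s x.1 := by
  constructor
  · intro h f hf hc
    refine h f fun x => ?_
    by_cases hx : x = c
    · subst hx; exact hc
    · exact hf ⟨x, hx⟩
  · exact fun h f hf => h f (fun x => hf x.1) (hf c)

/-! ### States of twists -/

theorem matches_twist_inc_iff (b b' : Bool) {n : ℕ} (i : Fin n) (g : Fin (n + 1) × Bool → Prop) :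
    Matches b' (fun k => g ((twist b n).inc i k)) ↔
      if b' = b then ∀ x, g (i.castSucc, x) ↔ g (i.succ, x)
      else (g (i.castSucc, false) ↔ g (i.castSucc, true)) ∧
        (g (i.succ, false) ↔ g (i.succ, true)) := by
  cases b <;> cases b' <;> simp [Matches] <;> tauto

theorem matches_twist_bd_iff (b b' : Bool) (n : ℕ) (g : Fin (n + 1) × Bool → Prop) :
    Matches b' (fun k => g ((twist b n).bd k)) ↔
      if b' = b then ∀ x, g (0, x) ↔ g (Fin.last n, x)
      else (g (0, false) ↔ g (0, true)) ∧ (g (Fin.last n, false) ↔ g (Fin.last n, true)) := by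
  cases b <;> cases b' <;> simp [Matches] <;> tauto

theorem exists_twist_bd (b : Bool) (n : ℕ) (x : Bool) :
    (∃ j, (twist b n).bd j = (0, x)) ∧ ∃ j, (twist b n).bd j = (Fin.last n, x) := by
  cases b <;> cases x
  exacts [⟨⟨0, rfl⟩, ⟨3, rfl⟩⟩, ⟨⟨1, rfl⟩, ⟨2, rfl⟩⟩, ⟨⟨0, rfl⟩, ⟨1, rfl⟩⟩, ⟨⟨3, rfl⟩, ⟨2, rfl⟩⟩]

/-- Each side of the twist becomes one arc through all levels, so `g (k, x)` is independent of `k`.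
-/
theorem connectedState_twist_const (O : Tangle 4) (b : Bool) (n : ℕ)
    (s : (O.glue (twist b n)).Crossing → Bool) (hs : ∀ i : Fin n, s (.inr i) = b) :
    (O.glue (twist b n)).ConnectedState s ↔ ConnectedClosure O b fun c => s (.inl c) := by
  rw [connectedState_glue_iff]
  constructor
  · intro h f hf hb x y
    let g : Fin (n + 1) × Bool → Prop := fun e => bif e.2 then f (O.bd 2) else f (O.bd 0)
    refine h f g ?_ hf ?_ (.inl x) (.inl y)
    · rw [forall_fin_four]
      cases b
      · exact ⟨Iff.rfl, hb.1, Iff.rfl, hb.2⟩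
      · exact ⟨Iff.rfl, hb.1.symm, Iff.rfl, hb.2.symm⟩
    · intro i
      rw [matches_twist_inc_iff, if_pos (hs i)]
      simp [g]
  · intro h f g hfg hf hg
    have hstep : ∀ k x, g (0, x) ↔ g (k, x) := by
      intro k x
      induction k using Fin.induction with
      | zero => rfl
      | succ i ih =>
        have := hg i
        rw [matches_twist_inc_iff, if_pos (hs i)] at this
        exact ih.trans (this x)
    have hb : Matches b fun j => f (O.bd j) := by
      simp only [hfg]
      rw [matches_twist_bd_iff, if_pos rfl]
      exact fun x => hstep _ x
    have hc := h f hf hb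
    have key : ∀ z, Sum.elim f g z ↔ f (O.bd 0) := by
      rintro (z | ⟨k, z⟩)
      · exact hc _ _
      · obtain ⟨⟨j, hj⟩, -⟩ := exists_twist_bd b n z
        have := hfg j
        rw [hj] at this
        exact ((hstep k z).symm.trans this.symm).trans (hc _ _)
    exact fun x y => (key x).trans (key y).symm

/-- The crossing `j` cuts the twist: the strands entering from either end turn back there, which
leaves the two arcs of `!b`. -/
theorem connectedState_twist_single (O : Tangle 4) (b : Bool) (n : ℕ)
    (s : (O.glue (twist b n)).Crossing → Bool) (j : Fin n)
    (hs : ∀ i : Fin n, s (.inr i) = b ↔ i ≠ j) :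
    (O.glue (twist b n)).ConnectedState s ↔ ConnectedClosure O (!b) fun c => s (.inl c) := by
  rw [connectedState_glue_iff]
  constructor
  · intro h f hf hb x y
    -- The boundary points `0` and `2` lie at opposite ends of the twist, hence on opposite sides of
    -- `j`.
    let g : Fin (n + 1) × Bool → Prop :=
      fun e => if e.1 ≤ j.castSucc then f (O.bd 0) else f (O.bd 2)
    refine h f g ?_ hf ?_ (.inl x) (.inl y)
    · have h0 : ∀ x, f (O.bd 0) ↔ g (0, x) := fun x => by simp [g]
      have h2 : ∀ x, f (O.bd 2) ↔ g (Fin.last n, x) := fun x => by simp [g, Fin.le_def]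
      rw [forall_fin_four]
      cases b
      · exact ⟨h0 _, hb.1.symm.trans (h0 _), h2 _, hb.2.symm.trans (h2 _)⟩
      · exact ⟨h0 _, hb.1.trans (h2 _), h2 _, hb.2.trans (h0 _)⟩
    · intro i
      rw [matches_twist_inc_iff]
      split_ifs with hi
      · have hij := (hs i).1 hi
        have : i.succ ≤ j.castSucc ↔ i.castSucc ≤ j.castSucc := by
          simp only [Fin.le_def, Fin.val_succ, Fin.val_castSucc]
          have : i.val ≠ j.val := fun h => hij (Fin.ext h)
          omega
        simp [g, this]
      · simp [g]
  · intro h f g hfg hf hg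
    have hstep : ∀ i : Fin n, i ≠ j → ∀ x, g (i.castSucc, x) ↔ g (i.succ, x) := by
      intro i hi
      have := hg i
      rwa [matches_twist_inc_iff, if_pos ((hs i).2 hi)] at this
    have hj := hg j
    rw [matches_twist_inc_iff, if_neg (fun h => (hs j).1 h rfl)] at hj
    have hlow : ∀ (k : Fin (n + 1)) x, k ≤ j.castSucc → (g (0, x) ↔ g (k, x)) := by
      intro k x
      induction k using Fin.induction with
      | zero => exact fun _ => Iff.rfl
      | succ i ih =>
        intro hi
        simp only [Fin.le_def, Fin.val_succ, Fin.val_castSucc] at hi ih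
        exact (ih (by omega)).trans (hstep i (by rintro rfl; omega) x)
    have hhigh : ∀ (k : Fin (n + 1)) x, j.succ ≤ k → (g (Fin.last n, x) ↔ g (k, x)) := by
      intro k x
      induction k using Fin.reverseInduction with
      | last => exact fun _ => Iff.rfl
      | cast i ih =>
        intro hi
        simp only [Fin.le_def, Fin.val_succ, Fin.val_castSucc] at hi ih
        exact (ih (by omega)).trans (hstep i (by rintro rfl; omega) x).symm
    have hb : Matches (!b) fun j => f (O.bd j) := by
      simp only [hfg]
      rw [matches_twist_bd_iff, if_neg (by simp), hlow _ _ le_rfl, hlow _ _ le_rfl,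
        hhigh _ _ le_rfl, hhigh _ _ le_rfl]
      exact hj
    have hc := h f hf hb
    have key : ∀ z, Sum.elim f g z ↔ f (O.bd 0) := by
      rintro (z | ⟨k, z⟩)
      · exact hc _ _
      · obtain ⟨⟨i, hi⟩, ⟨i', hi'⟩⟩ := exists_twist_bd b n z
        rcases le_or_gt k j.castSucc with hk | hk
        · have := hfg i
          rw [hi] at this
          exact ((hlow k z hk).symm.trans this.symm).trans (hc _ _)
        · have := hfg i'
          rw [hi'] at this
          refine ((hhigh k z ?_).symm.trans this.symm).trans (hc _ _)
          simp only [Fin.le_def, Fin.lt_def, Fin.val_succ, Fin.val_castSucc] at hk ⊢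
          omega
    exact fun x y => (key x).trans (key y).symm

theorem not_connectedState_twist (O : Tangle 4) (b : Bool) (n : ℕ)
    (s : (O.glue (twist b n)).Crossing → Bool) (j k : Fin n) (hjk : j < k)
    (hj : s (.inr j) ≠ b) (hk : s (.inr k) ≠ b) :
    ¬ (O.glue (twist b n)).ConnectedState s := by
  rw [connectedState_glue_iff]
  intro h
  -- The levels after `j` up to `k` form an invariant set that misses the boundary.
  let g : Fin (n + 1) × Bool → Prop := fun e => j.castSucc < e.1 ∧ e.1 ≤ k.castSucc
  have key := h (fun _ => False) g ?_ ?_ ?_ (.inr (0, false)) (.inr (k.castSucc, false))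
  · simp [g, hjk] at key
  · have h0 : ∀ x, False ↔ g (0, x) := fun x => by simp [g]
    have h1 : ∀ x, False ↔ g (Fin.last n, x) := fun x => by simp [g, Fin.le_def]
    rw [forall_fin_four]
    cases b
    · exact ⟨h0 _, h0 _, h1 _, h1 _⟩
    · exact ⟨h0 _, h1 _, h1 _, h0 _⟩
  · intro c
    simp [Matches]
  · intro i
    rw [matches_twist_inc_iff]
    split_ifs with hi
    · have h1 : i.val ≠ j.val := fun h => hj (Fin.ext h ▸ hi)
      have h2 : i.val ≠ k.val := fun h => hk (Fin.ext h ▸ hi)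
      simp only [g, Fin.le_def, Fin.lt_def, Fin.val_succ, Fin.val_castSucc]
      omega
    · simp [g]

/-! ### The bracket at `A = exp (π i / 4)` -/

/-- The number `exp (π i / 4)`. -/
noncomputable def zeta : ℂ := Complex.exp (Real.pi * Complex.I / 4)

/-- The weight of a crossing which is smoothed by `b`. -/
noncomputable def weight (b : Bool) : ℂ := if b = true then zeta else zeta⁻¹

theorem norm_zeta : ‖zeta‖ = 1 := by
  rw [zeta, show (Real.pi * Complex.I / 4 : ℂ) = ((Real.pi / 4 : ℝ) : ℂ) * Complex.I by
    push_cast; ring]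
  exact Complex.norm_exp_ofReal_mul_I _

theorem zeta_ne_zero : zeta ≠ 0 := Complex.exp_ne_zero _

theorem norm_weight (b : Bool) : ‖weight b‖ = 1 := by
  cases b <;> simp [weight, norm_zeta]

theorem weight_ne_zero (b : Bool) : weight b ≠ 0 := by
  cases b <;> simp [weight, zeta_ne_zero]

theorem circle_value_zeta : -zeta ^ (2 : ℤ) - zeta ^ (-2 : ℤ) = 0 := by
  have h : zeta ^ 2 = Complex.I := by
    rw [zeta, ← Complex.exp_nat_mul]
    refine Eq.trans ?_ Complex.exp_pi_div_two_mul_I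
    congr 1
    push_cast
    ring
  rw [zpow_neg, show (2 : ℤ) = ((2 : ℕ) : ℤ) from rfl, zpow_natCast, h]
  simp

/-- The product of the weights of the crossings in a state. -/
noncomputable def stateWeight {α : Type*} (s : α → Bool) : ℂ := ∏ᶠ c, weight (s c)

open Classical in
/-- The number `1` if `p` holds, else `0`. -/
noncomputable def truthValue (p : Prop) : ℂ := if p then 1 else 0

theorem zeta_zpow_eq_stateWeight {α : Type*} [Finite α] (s : α → Bool) :
    zeta ^ ((Nat.card {c // s c = true} : ℤ) - (Nat.card {c // s c = false} : ℤ)) =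
      stateWeight s := by
  classical
  have := Fintype.ofFinite α
  simp only [stateWeight, finprod_eq_prod_of_fintype, weight, Finset.prod_ite, Finset.prod_const,
    zpow_sub₀ zeta_ne_zero, zpow_natCast, inv_pow, div_eq_mul_inv, Nat.card_eq_fintype_card,
    Fintype.card_subtype, Bool.not_eq_true]

theorem stateWeight_sum {α β : Type*} [Finite α] [Finite β] (s : α ⊕ β → Bool) :
    stateWeight s = stateWeight (fun a => s (.inl a)) * stateWeight (fun b => s (.inr b)) := by
  have := Fintype.ofFinite α
  have := Fintype.ofFinite β
  simp only [stateWeight, finprod_eq_prod_of_fintype, Fintype.prod_sum_type]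

theorem stateWeight_eq_mul {α : Type*} [Finite α] (c : α) (s : α → Bool) :
    stateWeight s = weight (s c) * stateWeight fun x : {x // x ≠ c} => s x.1 := by
  classical
  have := Fintype.ofFinite α
  simp only [stateWeight, finprod_eq_prod_of_fintype]
  exact Fintype.prod_eq_mul_prod_subtype_ne _ c

theorem stateWeight_isEmpty {α : Type*} [IsEmpty α] (s : α → Bool) : stateWeight s = 1 :=
  finprod_of_isEmpty _

/-- States of the exterior of `c` correspond to states of the diagram with prescribed value at `c`.
-/
theorem finsum_ite_eq_restrict {α : Type*} [Finite α] (c : α) (b : Bool)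
    (H : ({x // x ≠ c} → Bool) → ℂ) :
    ∑ᶠ s : α → Bool, (if s c = b then H (fun x => s x.1) else 0) = ∑ᶠ t, H t := by
  classical
  have := Fintype.ofFinite α
  rw [← finsum_comp_equiv (Equiv.funSplitAt c Bool).symm, finsum_eq_sum_of_fintype,
    finsum_eq_sum_of_fintype, Fintype.sum_prod_type, Finset.sum_eq_single b]
  · refine Finset.sum_congr rfl fun t _ => ?_
    rw [if_pos (by simp [Equiv.funSplitAt])]
    congr 1
    funext x
    simp [Equiv.funSplitAt, x.2]
  · intro a _ ha
    exact Finset.sum_eq_zero fun t _ => if_neg (by simpa [Equiv.funSplitAt] using ha)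
  · simp

/-! ### The bracket as a sum over connected states -/

theorem bracket_zeta (D : PDCode) :
    D.bracket zeta =
      ∑ᶠ s : D.Crossing → Bool, stateWeight s * truthValue (D.ConnectedState s) := by
  refine finsum_congr fun s => ?_
  rw [zeta_zpow_eq_stateWeight, circle_value_zeta, connectedState_iff_circles_le_one, truthValue]
  congr 1
  split_ifs with h
  · rw [Nat.sub_eq_zero_of_le h, pow_zero]
  · exact zero_pow (by omega)

theorem bracket_smoothing (O : Tangle 4) (b : Bool) :
    (O.glue (smoothing b)).bracket zeta =
      ∑ᶠ s : O.Crossing → Bool, stateWeight s * truthValue (ConnectedClosure O b s) := by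
  rw [bracket_zeta, ← finsum_comp_equiv (Equiv.arrowCongr (Equiv.sumEmpty O.Crossing Empty)
    (Equiv.refl Bool))]
  refine finsum_congr fun s => ?_
  rw [connectedState_smoothing_iff]
  refine congrArg₂ (· * ·) ((stateWeight_sum (α := O.Crossing) (β := Empty) s).trans ?_) rfl
  exact (congrArg _ (stateWeight_isEmpty (α := Empty) _)).trans (mul_one _)

/-- The bracket of the smoothing `b` at `c` as a sum over the states of `D`. -/
theorem weight_mul_bracket_replace_smoothing (D : PDCode) (c : D.Crossing) (b : Bool) :
    weight b * (D.replace c (smoothing b)).bracket zeta =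
      ∑ᶠ s : D.Crossing → Bool, if s c = b then
        stateWeight s * truthValue (D.ConnectedState s) else 0 := by
  have h := finsum_ite_eq_restrict c b fun t =>
    weight b * (stateWeight t * truthValue (ConnectedClosure (D.exterior c) b t))
  rw [← mul_finsum] at h
  refine (congrArg _ (bracket_smoothing (D.exterior c) b)).trans (h.symm.trans ?_)
  refine finsum_congr fun s => ?_
  split_ifs with hs
  · rw [stateWeight_eq_mul c, connectedState_iff_exterior D c, hs, mul_assoc]
    rfl
  · rfl

/-- The Kauffman skein relation. -/
theorem bracket_skein (D : PDCode) (c : D.Crossing) (b : Bool) :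
    D.bracket zeta = weight b * (D.replace c (smoothing b)).bracket zeta +
      weight (!b) * (D.replace c (smoothing (!b))).bracket zeta := by
  rw [weight_mul_bracket_replace_smoothing, weight_mul_bracket_replace_smoothing, bracket_zeta,
    ← finsum_add_distrib (Set.toFinite _) (Set.toFinite _)]
  refine finsum_congr fun s => ?_
  cases b <;> cases s c <;> simp

/-! ### The brackets of the smoothings of a twist -/

/-- The state of a twist of type `b` in which the crossing `j` alone is smoothed by `!b`. -/
def single {n : ℕ} (b : Bool) (j : Fin n) : Fin n → Bool := fun i => if i = j then !b else b

/-- The indicators on the right exclude each other, so at most one term survives; none does when two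
twist crossings deviate from `b`. -/
theorem truthValue_connectedState_twist (O : Tangle 4) (b : Bool) {n : ℕ}
    (s : (O.glue (twist b n)).Crossing → Bool) (u : O.Crossing → Bool) (t : Fin n → Bool)
    (hu : ∀ c, s (.inl c) = u c) (ht : ∀ i : Fin n, s (.inr i) = t i) :
    truthValue ((O.glue (twist b n)).ConnectedState s) =
      (if t = fun _ => b then truthValue (ConnectedClosure O b u) else 0) +
      ∑ j, if t = single b j then truthValue (ConnectedClosure O (!b) u) else 0 := by
  obtain rfl : (fun c => s (.inl c)) = u := funext hu
  by_cases h0 : ∀ i, t i = b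
  · obtain rfl : t = fun _ => b := funext h0
    rw [if_pos rfl, Finset.sum_eq_zero, add_zero, connectedState_twist_const O b n s ht]
    intro j _
    rw [if_neg fun h => by simpa [single] using congrFun h j]
  have h0' : t ≠ fun _ => b := fun h => h0 (congrFun h)
  rw [if_neg h0', zero_add]
  push Not at h0
  obtain ⟨j, hj⟩ := h0
  by_cases h1 : ∀ i, i ≠ j → t i = b
  · have hts : t = single b j := by
      funext i
      by_cases hi : i = j
      · subst hi
        simpa [single] using Bool.eq_not_of_ne hj
      · simp [single, hi, h1 i hi]
    rw [Finset.sum_eq_single j, if_pos hts, connectedState_twist_single O b n s j]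
    · intro i
      rw [ht]
      exact ⟨fun h hi => hj (hi ▸ h), h1 i⟩
    · intro i _ hi
      rw [if_neg fun h => hj (by simp [h, single, hi.symm])]
    · simp
  · push Not at h1
    obtain ⟨k, hkj, hk⟩ := h1
    rw [Finset.sum_eq_zero]
    · refine if_neg ?_
      rcases lt_or_gt_of_ne hkj with h | h
      · exact not_connectedState_twist O b n s k j h (ht k ▸ hk) (ht j ▸ hj)
      · exact not_connectedState_twist O b n s j k h (ht j ▸ hj) (ht k ▸ hk)
    · intro i _
      refine if_neg fun h => ?_
      subst h
      simp only [single, ne_eq, ite_eq_right_iff, Classical.not_imp] at hj hk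
      exact hkj (hk.1.trans hj.1.symm)

/-- This separates the sum over outer states from that over twist states; `F` carries the twist
weights and any constraint on the twist state. -/
theorem finsum_states_eq_of_support {α : Type*} [Finite α] {n : ℕ} (b : Bool)
    (F : (Fin n → Bool) → ℂ) (C : (α ⊕ Fin n → Bool) → ℂ) (P Q : (α → Bool) → ℂ)
    (hC : ∀ s u t, (∀ c, s (.inl c) = u c) → (∀ i, s (.inr i) = t i) →
      C s = (if t = fun _ => b then P u else 0) + ∑ j, if t = single b j then Q u else 0) :
    ∑ᶠ s : α ⊕ Fin n → Bool, F (fun i => s (.inr i)) * (stateWeight (fun c => s (.inl c)) * C s) =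
      F (fun _ => b) * (∑ᶠ u, stateWeight u * P u) +
        (∑ j, F (single b j)) * ∑ᶠ u, stateWeight u * Q u := by
  classical
  have := Fintype.ofFinite α
  rw [← finsum_comp_equiv (Equiv.sumArrowEquivProdArrow α (Fin n) Bool).symm,
    finsum_eq_sum_of_fintype, finsum_eq_sum_of_fintype, finsum_eq_sum_of_fintype,
    Fintype.sum_prod_type, Finset.mul_sum, Finset.mul_sum, ← Finset.sum_add_distrib]
  refine Finset.sum_congr rfl fun u _ => ?_
  have hstep : ∀ t : Fin n → Bool, F t * (stateWeight u * C (Sum.elim u t)) =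
      (if t = fun _ => b then F t * (stateWeight u * P u) else 0) +
      ∑ j, if t = single b j then F t * (stateWeight u * Q u) else 0 := by
    intro t
    rw [hC (Sum.elim u t) u t (fun _ => rfl) fun _ => rfl, mul_add, mul_add, Finset.mul_sum,
      Finset.mul_sum]
    simp only [mul_ite, mul_zero]
  refine (Finset.sum_congr rfl fun t _ => hstep t).trans ?_
  rw [Finset.sum_add_distrib, Finset.sum_comm, Finset.sum_mul]
  simp

theorem weight_mul_bracket_twist_smoothing (D : PDCode) (c : D.Crossing) (b b' : Bool) {n : ℕ}
    (i : Fin n) :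
    weight b' * ((D.replace c (twist b n)).replace (.inr i) (smoothing b')).bracket zeta =
      (if b = b' then stateWeight (fun _ : Fin n => b) else 0) *
        (D.replace c (smoothing b)).bracket zeta +
      (∑ j, if single b j i = b' then stateWeight (single b j) else 0) *
        (D.replace c (smoothing (!b))).bracket zeta := by
  have hb := fun b => bracket_smoothing (D.exterior c) b
  refine (weight_mul_bracket_replace_smoothing (D.replace c (twist b n)) (.inr i) b').trans ?_
  have key := finsum_states_eq_of_support b
    (fun t : Fin n → Bool => if t i = b' then stateWeight t else 0) _ _ _
    (truthValue_connectedState_twist (D.exterior c) b)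
  rw [← hb, ← hb] at key
  refine Eq.trans (finsum_congr fun s => ?_) key
  have hw := stateWeight_sum (α := (D.exterior c).Crossing) (β := Fin n) s
  refine (congrArg (fun w => if s (.inr i) = b' then w * _ else 0) hw).trans ?_
  dsimp only
  split_ifs
  · rw [mul_comm (stateWeight _), mul_assoc]
    rfl
  · rw [zero_mul]

theorem stateWeight_const (b : Bool) (n : ℕ) :
    stateWeight (fun _ : Fin n => b) = weight b ^ n := by
  simp [stateWeight, finprod_eq_prod_of_fintype]

theorem stateWeight_single (b : Bool) {m : ℕ} (j : Fin (m + 1)) :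
    stateWeight (single b j) = weight (!b) * weight b ^ m := by
  rw [stateWeight, finprod_eq_prod_of_fintype, Fintype.prod_eq_mul_prod_subtype_ne _ j,
    Finset.prod_congr rfl fun (k : {k // k ≠ j}) _ =>
      show weight (single b j k) = weight b by rw [single, if_neg k.2]]
  simp [single]

theorem bracket_twist_smoothing_self (D : PDCode) (c : D.Crossing) (b : Bool) {m : ℕ}
    (i : Fin (m + 2)) :
    ((D.replace c (twist b (m + 2))).replace (.inr i) (smoothing b)).bracket zeta =
      weight b ^ m * (weight b * (D.replace c (smoothing b)).bracket zeta +
        (m + 1 : ℝ) • (weight (!b) * (D.replace c (smoothing (!b))).bracket zeta)) := by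
  have h := weight_mul_bracket_twist_smoothing D c b b i
  have hs : ∀ j, (single b j i = b) ↔ j ≠ i := by
    intro j
    by_cases hij : i = j
    · simp [single, hij]
    · simp [single, hij, Ne.symm hij]
  simp only [hs, stateWeight_single, stateWeight_const, if_true] at h
  -- The deviating crossing can be any of the `m + 1` crossings other than `i`.
  rw [← Finset.sum_filter, Finset.sum_const, Finset.filter_ne', Finset.card_erase_of_mem
    (Finset.mem_univ i), Finset.card_univ, Fintype.card_fin] at h
  refine mul_left_cancel₀ (weight_ne_zero b) (h.trans ?_)
  rw [Complex.real_smul]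
  simp only [nsmul_eq_mul]
  push_cast
  ring

/-- The crossing `i` already deviates from `b`, so only the state `single b i` contributes. -/
theorem bracket_twist_smoothing_not (D : PDCode) (c : D.Crossing) (b : Bool) {m : ℕ}
    (i : Fin (m + 1)) :
    ((D.replace c (twist b (m + 1))).replace (.inr i) (smoothing (!b))).bracket zeta =
      weight b ^ m * (D.replace c (smoothing (!b))).bracket zeta := by
  have h := weight_mul_bracket_twist_smoothing D c b (!b) i
  have hs : ∀ j, (single b j i = !b) ↔ j = i := by
    intro j
    by_cases hij : i = j
    · simp [single, hij]
    · simp [single, hij, Ne.symm hij]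
  simp only [hs, stateWeight_single] at h
  refine mul_left_cancel₀ (weight_ne_zero (!b)) (h.trans ?_)
  simp [mul_assoc]

/-! ### Comparison of the determinants -/

/-- Equality in the triangle inequality means that `u` and `v` lie on a common ray, a property kept
by nonnegative scaling of `v`. -/
theorem norm_add_smul_of_norm_add {u v : ℂ} (h : ‖u + v‖ = ‖u‖ + ‖v‖) {r : ℝ} (hr : 0 ≤ r) :
    ‖u + r • v‖ = ‖u‖ + r * ‖v‖ := by
  have h' : SameRay ℝ u (r • v) := (sameRay_iff_norm_add.2 h).nonneg_smul_right hr
  rw [h'.norm_add, norm_smul, Real.norm_of_nonneg hr]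

theorem det_twist_smoothing_lt (D : PDCode) (c : D.Crossing) (b : Bool)
    (hpos : 1 ≤ (D.replace c (smoothing b)).det)
    (hadd : D.det = (D.replace c (smoothing b)).det + (D.replace c (smoothing (!b))).det)
    {n : ℕ} (hn : 1 < n) (i : Fin n) :
    ((D.replace c (twist b n)).replace (.inr i) (smoothing (!b))).det <
      ((D.replace c (twist b n)).replace (.inr i) (smoothing b)).det := by
  obtain ⟨m, rfl⟩ : ∃ m, n = m + 2 := ⟨n - 2, by omega⟩
  have hdet : ∀ E : PDCode, E.det = ‖E.bracket zeta‖ := fun _ => rfl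
  simp only [hdet] at hpos hadd ⊢
  rw [bracket_twist_smoothing_self, bracket_twist_smoothing_not D c b (m := m + 1)]
  rw [bracket_skein D c b] at hadd
  have hm : (0 : ℝ) ≤ m := Nat.cast_nonneg m
  rw [norm_mul, norm_mul, norm_add_smul_of_norm_add (by simpa [norm_weight] using hadd)
    (by positivity)]
  simp only [norm_mul, norm_pow, norm_weight, one_pow, one_mul]
  -- With `x ≥ 1` and `y ≥ 0` the two norms, the claim is `y < x + (m + 1) * y`.
  nlinarith [norm_nonneg ((D.replace c (smoothing (!b))).bracket zeta)]

end PDCode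

theorem mainTheorem9 (L : PDCode) (c : L.Crossing) (hc : L.IsQuasiAlternatingAt c)
    (n : ℕ) (hn : 1 < n) :
    (∀ i : Fin n,
      ((L.verticalTwist c n).smoothInfty (L.verticalCrossing c n i)).det <
        ((L.verticalTwist c n).smoothZero (L.verticalCrossing c n i)).det) ∧
    (∀ i : Fin n,
      ((L.horizontalTwist c n).smoothInfty (L.horizontalCrossing c n i)).det >
        ((L.horizontalTwist c n).smoothZero (L.horizontalCrossing c n i)).det) := by
  obtain ⟨-, -, -, h0, h1, hadd⟩ := hc
  -- The uniform tangles unfold to the given ones; in the horizontal case the two smoothings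
  -- exchange roles.
  exact ⟨L.det_twist_smoothing_lt c true h0 hadd hn,
    L.det_twist_smoothing_lt c false h1 (hadd.trans (add_comm _ _)) hn⟩
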